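/- Let $\mathbb H=\mathbb R^2\times\mathbb R$ be the first Heisenberg group, with the group law $(X,t)\cdot(Y,s)=\bigl(X+Y,\,t+s+\tfrac12(X_1Y_2-X_2Y_1)\bigr)$, the gauge $\|(X,t)\|=(|X|^2+|t|)^{1/2}$, the left-invariant distance $d(\mathbf X,\mathbf Y)=\|\mathbf Y^{-1}\cdot\mathbf X\|$ and the balls $B_r(\mathbf X)=\{\mathbf Y: d(\mathbf Y,\mathbf X)<r\}$; equip $\mathbb R$ with the distance $\sqrt{|a-b|}$. All measures are locally finite Borel measures. A measure $\mu$ on one of these two spaces is $s$-ADR (or $s$-regular) with constant $C\in(0,\infty)$ if $C^{-1}r^s\le\mu(B_r(x))\le Cr^s$ for all $x\in\operatorname{supp}\mu$ and $0<r<\operatorname{diam}(\operatorname{supp}\mu)$, with balls and diameter (possibly $\infty$) taken with respect to the given distance; on $\mathbb R$ the ball $B_r(a)$ is thus $(a-r^2,a+r^2)$. A measure $\mu$ on $\mathbb H$ is vampiric if $$\int_{\mathbb H}\psi(\mathbf Y^{-1}\cdot\mathbf X)\,d\mu(\mathbf Y)=0\qquad\text{for every }\mathbf X\in\operatorname{supp}\mu$$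 and every compactly supported function $\psi:\mathbb H\to\mathbb R$ that is Lipschitz with respect to $d$ and satisfies $\psi(-X,t)=-\psi(X,t)$ for all $(X,t)$. **Theorem.** (1) For every $C_0$ there is $A_0$, depending only on $C_0$, such that the following holds. Let $\mu$ be a vampiric measure on $\mathbb H$ that is $3$-ADR with constant $C_0$, whose support contains the origin and is not a single point. Then $\mu=\mathcal H^1|_L\times\nu$ for some line $L\subset\mathbb R^2$ through the origin and some measure $\nu$ on $\mathbb R$ that is $2$-ADR with constant $A_0$. (2) Conversely, for every line $L\subset\mathbb R^2$ through the origin and every locally finite Borel measure $\nu$ on $\mathbb R$ (in particular for every $2$-ADR measure $\nu$), the measure $\mathcal H^1|_L\times\nu$ is vampiric. -/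

import Mathlib

noncomputable section

/-- The underlying space `ℝ² × ℝ` of the first Heisenberg group, points being written `(X, t)`.
Its topology and Borel σ-algebra are the usual ones of `ℝ³`. -/
abbrev Heis : Type := EuclideanSpace ℝ (Fin 2) × ℝ

namespace Heis

/-- The group law `(X, t) · (Y, s) = (X + Y, t + s + (X₁ Y₂ - X₂ Y₁) / 2)`. -/
def mul (X Y : Heis) : Heis :=
  (X.1 + Y.1, X.2 + Y.2 + (1 / 2 : ℝ) * (X.1 0 * Y.1 1 - X.1 1 * Y.1 0))

/-- The inverse `(X, t)⁻¹ = (-X, -t)` for the group law `Heis.mul`. -/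
def inv (X : Heis) : Heis := (-X.1, -X.2)

/-- The homogeneous gauge `‖(X, t)‖ = (|X|² + |t|)^{1/2}`. -/
def gauge (X : Heis) : ℝ := Real.sqrt (‖X.1‖ ^ 2 + |X.2|)

/-- The left-invariant distance `d(X, Y) = ‖Y⁻¹ · X‖`. -/
def hdist (X Y : Heis) : ℝ := gauge (mul (inv Y) X)

/-- Compactly supported functions on the Heisenberg group which are Lipschitz for `Heis.hdist`
and odd in the spatial variable, `ψ(-X, t) = -ψ(X, t)`. -/
def IsOddLip (ψ : Heis → ℝ) : Prop :=
  (∃ K : ℝ, ∀ X Y : Heis, |ψ X - ψ Y| ≤ K * hdist X Y) ∧ HasCompactSupport ψ ∧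
    ∀ (x : EuclideanSpace ℝ (Fin 2)) (t : ℝ), ψ (-x, t) = -ψ (x, t)

/-- A measure `μ` is vampiric if `∫ ψ(Y⁻¹ · X) dμ(Y) = 0` for every `X` in its support and every
compactly supported Lipschitz function `ψ` that is odd in the spatial variable. -/
def IsVampiric (μ : MeasureTheory.Measure Heis) : Prop :=
  ∀ ψ : Heis → ℝ, IsOddLip ψ → ∀ X ∈ μ.support, ∫ Y, ψ (mul (inv Y) X) ∂μ = 0

end Heis

/-- The distance `√|a - b|` on the time axis. -/
def timeDist (a b : ℝ) : ℝ := Real.sqrt |a - b|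

/-- The diameter, possibly infinite, of a set with respect to a distance function `d`. -/
def distDiam {α : Type*} (d : α → α → ℝ) (S : Set α) : ENNReal :=
  ⨆ x ∈ S, ⨆ y ∈ S, ENNReal.ofReal (d x y)

/-- `μ` is `s`-Ahlfors-David regular with constant `C` with respect to the distance function `d`:
`C⁻¹ r ^ s ≤ μ(B(x, r)) ≤ C r ^ s` for all `x ∈ supp μ` and `0 < r < diam (supp μ)`. -/
def IsADR {α : Type*} [TopologicalSpace α] [MeasurableSpace α] (d : α → α → ℝ) (s : ℕ) (C : ℝ)
    (μ : MeasureTheory.Measure α) : Prop :=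
  0 < C ∧ ∀ x ∈ μ.support, ∀ r : ℝ, 0 < r → ENNReal.ofReal r < distDiam d μ.support →
    ENNReal.ofReal (C⁻¹ * r ^ s) ≤ μ {y | d y x < r} ∧ μ {y | d y x < r} ≤ ENNReal.ofReal (C * r ^ s)

/-- The measure `ℋ¹|_L × ν` on `ℝ² × ℝ`. -/
def lineProd (L : Submodule ℝ (EuclideanSpace ℝ (Fin 2))) (ν : MeasureTheory.Measure ℝ) :
    MeasureTheory.Measure Heis :=
  ((MeasureTheory.Measure.hausdorffMeasure 1).restrict
    (L : Set (EuclideanSpace ℝ (Fin 2)))).prod ν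

end

open MeasureTheory Filter Topology

/-! Testing against `f - f ∘ flip` shows that `μ` is invariant under the reflection at each point of
its support (`IsVampiric.map_reflect`). Composing the reflections at `X` and at the origin gives
invariance under left translation by the horizontal element `(2 X.1, 0)` (`IsVampiric.fixes`).

Two independent such translations generate, through their commutator, a lattice of growth of order
4, against the `r ^ 3` upper bound (`IsADR.area_eq_zero`). So the support lies in a vertical plane
`ℝ e × ℝ`. Vertical lines are null, so the support has uncountable projection to `ℝ e`. Its
translation periods are therefore not cyclic, hence dense, and by weak continuity `μ` is invariant
under all translations along `e`. Uniqueness of Haar measure on `ℝ` splits off Lebesgue measure, and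
comparing balls with boxes gives the regularity of `ν`.

Conversely, `area` vanishes on such a plane, so the group law is additive there, and the symmetry of
Lebesgue measure about any point kills odd kernels. -/

/-! ### Uniqueness and translation invariance of measures -/

theorem measure_ext_of_isCompact {α : Type*} [PseudoMetricSpace α] [ProperSpace α]
    [MeasurableSpace α] [BorelSpace α] {μ ν : Measure α}
    [IsFiniteMeasureOnCompacts μ] [IsFiniteMeasureOnCompacts ν]
    (h : ∀ K : Set α, IsCompact K → μ K = ν K) : μ = ν := by
  have : IsLocallyFiniteMeasure μ := isLocallyFiniteMeasure_of_isFiniteMeasureOnCompacts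
  have : IsLocallyFiniteMeasure ν := isLocallyFiniteMeasure_of_isFiniteMeasureOnCompacts
  refine Measure.OuterRegular.ext_isOpen fun U hU => ?_
  rw [hU.measure_eq_iSup_isCompact, hU.measure_eq_iSup_isCompact]
  exact iSup_congr fun K => iSup_congr fun _ => iSup_congr fun hK => h K hK

theorem hasCompactSupport_thickenedIndicator {α : Type*} [MetricSpace α] [ProperSpace α]
    {K : Set α} (hK : IsCompact K) {δ : ℝ} (hδ : 0 < δ) :
    HasCompactSupport fun x => (thickenedIndicator hδ K x : ℝ) := by
  refine HasCompactSupport.intro (hK.cthickening (r := δ)) fun x hx => ?_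
  have : x ∉ Metric.thickening δ K := fun h => hx (Metric.thickening_subset_cthickening _ _ h)
  simp [thickenedIndicator_zero hδ K this]

/-- Thickened indicators are Lipschitz and lie between the indicators of `K` and of its closed
thickening, which shrinks to `K`. Lipschitz test functions have to suffice, since the vampiric
condition provides no others. -/
theorem measure_isCompact_le_of_integral_eq {α : Type*} [MetricSpace α] [ProperSpace α]
    [MeasurableSpace α] [BorelSpace α] {μ ν : Measure α}
    [IsFiniteMeasureOnCompacts μ] [IsFiniteMeasureOnCompacts ν]
    (h : ∀ (f : α → ℝ) (C : NNReal), LipschitzWith C f → HasCompactSupport f →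
      ∫ x, f x ∂μ = ∫ x, f x ∂ν) {K : Set α} (hK : IsCompact K) : μ K ≤ ν K := by
  have : IsLocallyFiniteMeasure ν := isLocallyFiniteMeasure_of_isFiniteMeasureOnCompacts
  have key : ∀ δ : ℝ, 0 < δ → μ K ≤ ν (Metric.cthickening δ K) := by
    intro δ hδ
    set f : α → ℝ := fun x => (thickenedIndicator hδ K x : ℝ) with hf
    have hfs : HasCompactSupport f := hasCompactSupport_thickenedIndicator hK hδ
    have hlip : LipschitzWith (δ.toNNReal)⁻¹ f := fun x y =>
      lipschitzWith_thickenedIndicator hδ K x y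
    have h0 : ∀ x, 0 ≤ f x := fun x => NNReal.coe_nonneg _
    have hcoe : ∀ x, ENNReal.ofReal (f x) = (thickenedIndicator hδ K x : ENNReal) := fun x => by
      simp [hf, ENNReal.ofReal_coe_nnreal]
    have e1 := ofReal_integral_eq_lintegral_ofReal
      (hlip.continuous.integrable_of_hasCompactSupport (μ := μ) hfs) (ae_of_all _ h0)
    have e2 := ofReal_integral_eq_lintegral_ofReal
      (hlip.continuous.integrable_of_hasCompactSupport (μ := ν) hfs) (ae_of_all _ h0)
    calc μ K ≤ ∫⁻ x, (thickenedIndicator hδ K x : ENNReal) ∂μ :=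
          measure_le_lintegral_thickenedIndicator μ hK.measurableSet hδ
      _ = ∫⁻ x, ENNReal.ofReal (f x) ∂ν := by
          simp_rw [← hcoe]; rw [← e1, h f _ hlip hfs, e2]
      _ ≤ ∫⁻ x, (Metric.cthickening δ K).indicator 1 x ∂ν := by
          refine lintegral_mono fun x => ?_
          by_cases hx : x ∈ Metric.cthickening δ K
          · rw [Set.indicator_of_mem hx, hcoe]
            simpa only [Pi.one_apply, ENNReal.coe_le_one_iff]
              using thickenedIndicator_le_one hδ K x
          · have : x ∉ Metric.thickening δ K :=
              fun h => hx (Metric.thickening_subset_cthickening _ _ h)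
            rw [hcoe, thickenedIndicator_zero hδ K this]
            simp
      _ = ν (Metric.cthickening δ K) := by
          rw [lintegral_indicator_one Metric.isClosed_cthickening.measurableSet]
  have ht : Tendsto (fun r => ν (Metric.cthickening r K)) (𝓝[>] 0) (𝓝 (ν K)) :=
    (tendsto_measure_cthickening_of_isCompact hK).mono_left nhdsWithin_le_nhds
  exact ge_of_tendsto ht (by filter_upwards [self_mem_nhdsWithin] with r hr using key r hr)

theorem measure_ext_of_integral_lipschitz {α : Type*} [MetricSpace α] [ProperSpace α]
    [MeasurableSpace α] [BorelSpace α] {μ ν : Measure α}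
    [IsFiniteMeasureOnCompacts μ] [IsFiniteMeasureOnCompacts ν]
    (h : ∀ (f : α → ℝ) (C : NNReal), LipschitzWith C f → HasCompactSupport f →
      ∫ x, f x ∂μ = ∫ x, f x ∂ν) : μ = ν :=
  measure_ext_of_isCompact fun _ hK =>
    le_antisymm (measure_isCompact_le_of_integral_eq h hK)
      (measure_isCompact_le_of_integral_eq (fun f C hf hs => (h f C hf hs).symm) hK)

/-- If `w ∈ T` is within `r` of `v`, then `v + x ∈ K` puts `w + x` in the `r`-thickening of `K`; let
`r → 0`. The reverse inequality will come from `-v`. -/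
theorem isCompact_measure_preimage_add_le_of_dense {α : Type*} [NormedAddCommGroup α]
    [ProperSpace α] [MeasurableSpace α] [BorelSpace α] {μ : Measure α}
    [IsFiniteMeasureOnCompacts μ] {T : Set α}
    (hinv : ∀ v ∈ T, μ.map (v + ·) = μ) {v : α} (hv : v ∈ closure T)
    {K : Set α} (hK : IsCompact K) : μ ((v + ·) ⁻¹' K) ≤ μ K := by
  have : IsLocallyFiniteMeasure μ := isLocallyFiniteMeasure_of_isFiniteMeasureOnCompacts
  have ht : Tendsto (fun r => μ (Metric.cthickening r K)) (𝓝[>] 0) (𝓝 (μ K)) :=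
    (tendsto_measure_cthickening_of_isCompact hK).mono_left nhdsWithin_le_nhds
  refine ge_of_tendsto ht ?_
  filter_upwards [self_mem_nhdsWithin] with r hr
  obtain ⟨w, hwT, hw⟩ := Metric.mem_closure_iff.1 hv r hr
  calc μ ((v + ·) ⁻¹' K) ≤ μ ((w + ·) ⁻¹' Metric.cthickening r K) := by
        refine measure_mono fun x hx => ?_
        refine Metric.mem_cthickening_of_dist_le _ _ _ _ hx ?_
        rw [dist_add_right, dist_comm]; exact hw.le
    _ = μ (Metric.cthickening r K) := by
        rw [← Measure.map_apply (measurable_const_add w)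
          Metric.isClosed_cthickening.measurableSet, hinv w hwT]

theorem map_add_left_eq_of_mem_closure {α : Type*} [NormedAddCommGroup α]
    [ProperSpace α] [MeasurableSpace α] [BorelSpace α] {μ : Measure α}
    [IsFiniteMeasureOnCompacts μ] {T : AddSubgroup α}
    (hinv : ∀ v ∈ T, μ.map (v + ·) = μ) {v : α} (hv : v ∈ closure (T : Set α)) :
    μ.map (v + ·) = μ := by
  have : IsFiniteMeasureOnCompacts (μ.map (v + ·)) :=
    Measure.IsFiniteMeasureOnCompacts.map μ (Homeomorph.addLeft v)
  refine measure_ext_of_isCompact fun K hK => ?_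
  rw [Measure.map_apply (measurable_const_add v) hK.measurableSet]
  refine le_antisymm (isCompact_measure_preimage_add_le_of_dense hinv hv hK) ?_
  have hv' : -v ∈ closure (T : Set α) := T.topologicalClosure.neg_mem hv
  have hK' : IsCompact ((v + ·) ⁻¹' K) := (Homeomorph.addLeft v).isCompact_preimage.2 hK
  have := isCompact_measure_preimage_add_le_of_dense hinv hv' hK'
  rwa [← Set.preimage_comp, show ((v + ·) ∘ (-v + ·) : α → α) = id by ext x; simp,
    Set.preimage_id] at this

/-- A locally finite measure on the plane which is invariant under all horizontal translations
is the product of Lebesgue measure and a locally finite measure. -/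
theorem exists_eq_volume_prod {m : Measure (ℝ × ℝ)} [IsLocallyFiniteMeasure m]
    (hinv : ∀ r : ℝ, m.map (((r, 0) : ℝ × ℝ) + ·) = m) :
    ∃ ν : Measure ℝ, IsLocallyFiniteMeasure ν ∧ m = volume.prod ν := by
  have hbox : ∀ A B : Set ℝ, IsCompact A → IsCompact B → m (A ×ˢ B) < ⊤ := fun A B hA hB =>
    (hA.prod hB).measure_lt_top
  set ν : Measure ℝ := (m.restrict (Set.Icc (0 : ℝ) 1 ×ˢ Set.univ)).map Prod.snd with hν
  have hνapp : ∀ B, MeasurableSet B → ν B = m (Set.Icc (0 : ℝ) 1 ×ˢ B) := by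
    intro B hB
    rw [hν, Measure.map_apply measurable_snd hB, Measure.restrict_apply (measurable_snd hB)]
    congr 1
    ext p
    simp [and_comm]
  have hνc : IsFiniteMeasureOnCompacts ν := ⟨fun K hK => by
    rw [hνapp K hK.measurableSet]; exact hbox _ _ isCompact_Icc hK⟩
  have hνl : IsLocallyFiniteMeasure ν := isLocallyFiniteMeasure_of_isFiniteMeasureOnCompacts
  have hprod : ∀ A B : Set ℝ, MeasurableSet A → MeasurableSet B → (∃ K, IsCompact K ∧ B ⊆ K) →
      m (A ×ˢ B) = volume A * ν B := by
    rintro A B hA hB ⟨K, hK, hBK⟩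
    -- For fixed bounded `B`, the mass over `A` is a translation-invariant, locally finite function
    -- of `A`, hence a multiple of Lebesgue measure; `A = [0, 1]` identifies the factor as `ν B`.
    set mB : Measure ℝ := (m.restrict (Set.univ ×ˢ B)).map Prod.fst with hmB
    have hmBapp : ∀ A, MeasurableSet A → mB A = m (A ×ˢ B) := by
      intro A hA
      rw [hmB, Measure.map_apply measurable_fst hA, Measure.restrict_apply (measurable_fst hA)]
      congr 1
      ext p
      simp
    have : IsFiniteMeasureOnCompacts mB := ⟨fun J hJ => by
      rw [hmBapp J hJ.measurableSet]
      exact (measure_mono (Set.prod_mono_right hBK)).trans_lt (hbox _ _ hJ hK)⟩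
    have : mB.IsAddLeftInvariant := ⟨fun r => by
      ext J hJ
      rw [Measure.map_apply (measurable_const_add r) hJ, hmBapp _ hJ,
        hmBapp _ (measurable_const_add r hJ)]
      conv_rhs => rw [← hinv r, Measure.map_apply (measurable_const_add _) (hJ.prod hB)]
      congr 1
      ext p
      simp⟩
    obtain ⟨c, hc⟩ : ∃ c : NNReal, mB = c • (volume : Measure ℝ) :=
      ⟨_, Measure.isAddLeftInvariant_eq_smul mB volume⟩
    have h1 : ν B = c := by
      rw [hνapp B hB, ← hmBapp _ measurableSet_Icc, hc]
      simp
    rw [← hmBapp A hA, h1, hc, Measure.smul_apply, ENNReal.smul_def, smul_eq_mul, mul_comm]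
  refine ⟨ν, hνl, ?_⟩
  symm
  refine Measure.prod_eq fun A B hA hB => ?_
  have hmono : Monotone fun n : ℕ => B ∩ Set.Icc (-(n : ℝ)) n := by
    intro i j hij
    have : (i : ℝ) ≤ j := by exact_mod_cast hij
    exact Set.inter_subset_inter_right _ (Set.Icc_subset_Icc (by linarith) this)
  have hU : ⋃ n : ℕ, B ∩ Set.Icc (-(n : ℝ)) n = B := by
    rw [← Set.inter_iUnion, Set.inter_eq_left]
    intro x _
    obtain ⟨n, hn⟩ := exists_nat_ge |x|
    exact Set.mem_iUnion.2 ⟨n, abs_le.1 hn⟩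
  have e1 : m (A ×ˢ B) = ⨆ n : ℕ, m (A ×ˢ (B ∩ Set.Icc (-(n : ℝ)) n)) := by
    conv_lhs => rw [← hU, Set.prod_iUnion]
    exact Monotone.measure_iUnion fun i j hij => Set.prod_mono_right (hmono hij)
  have e2 : ν B = ⨆ n : ℕ, ν (B ∩ Set.Icc (-(n : ℝ)) n) := by
    conv_lhs => rw [← hU]
    exact hmono.measure_iUnion
  rw [e1, e2, ENNReal.mul_iSup]
  exact iSup_congr fun n => hprod _ _ hA (hB.inter measurableSet_Icc)
    ⟨_, isCompact_Icc, Set.inter_subset_right⟩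

/-! ### Heisenberg geometry and invariance under reflections -/

namespace Heis

/-- The symplectic form on the plane. -/
noncomputable def area (a b : EuclideanSpace ℝ (Fin 2)) : ℝ := a 0 * b 1 - a 1 * b 0

/-- The conjugate of the reflection `(X, t) ↦ (-X, t)` by the left translation by any point of the
vertical line over `x`. -/
noncomputable def reflect (x : EuclideanSpace ℝ (Fin 2)) (Y : Heis) : Heis :=
  (x + x - Y.1, Y.2 - area x Y.1)

theorem abs_area_le (a b : EuclideanSpace ℝ (Fin 2)) : |area a b| ≤ 2 * ‖a‖ * ‖b‖ := by
  have ha : ∀ i, |a i| ≤ ‖a‖ := fun i => PiLp.norm_apply_le a i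
  have hb : ∀ i, |b i| ≤ ‖b‖ := fun i => PiLp.norm_apply_le b i
  calc |area a b| ≤ |a 0 * b 1| + |a 1 * b 0| := abs_sub _ _
    _ ≤ ‖a‖ * ‖b‖ + ‖a‖ * ‖b‖ := by
        rw [abs_mul, abs_mul]
        gcongr <;> first | exact ha _ | exact hb _
    _ = _ := by ring

theorem hdist_eq (X Y : Heis) :
    hdist X Y = Real.sqrt (‖X.1 - Y.1‖ ^ 2 + |X.2 - Y.2 - (1 / 2) * area Y.1 X.1|) := by
  have h : -Y.2 + X.2 + 1 / 2 * ((-Y.1) 0 * X.1 1 - (-Y.1) 1 * X.1 0) =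
      X.2 - Y.2 - (1 / 2) * area Y.1 X.1 := by
    simp only [area, PiLp.neg_apply]
    ring
  simp only [hdist, gauge, mul, inv]
  rw [neg_add_eq_sub, h]

theorem hdist_nonneg (X Y : Heis) : 0 ≤ hdist X Y := Real.sqrt_nonneg _

theorem hdist_comm (X Y : Heis) : hdist X Y = hdist Y X := by
  rw [hdist_eq, hdist_eq, norm_sub_rev, ← abs_neg]
  congr 3
  simp only [area]
  ring

theorem hdist_zero_right (X : Heis) : hdist X 0 = gauge X := by
  rw [hdist_eq]
  simp [gauge, area]

theorem hdist_sq (X Y : Heis) :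
    hdist X Y ^ 2 = ‖X.1 - Y.1‖ ^ 2 + |X.2 - Y.2 - (1 / 2) * area Y.1 X.1| := by
  rw [hdist_eq, Real.sq_sqrt (by positivity)]

/-- The twist `area Y.1 X.1` equals `area Y.1 (X.1 - Y.1)`, so it is linear in the displacement; the
vertical term is at most `hdist ^ 2 ≤ hdist`. -/
theorem dist_le_hdist {X Y : Heis} {M : ℝ} (hM : ‖Y.1‖ ≤ M) (h1 : hdist X Y ≤ 1) :
    dist X Y ≤ (2 + M) * hdist X Y := by
  have h0 := hdist_nonneg X Y
  have hsq := hdist_sq X Y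
  have hM0 : 0 ≤ M := (norm_nonneg _).trans hM
  have hx : ‖X.1 - Y.1‖ ≤ hdist X Y := by
    refine abs_le_of_sq_le_sq' ?_ h0 |>.2
    have := abs_nonneg (X.2 - Y.2 - (1 / 2) * area Y.1 X.1)
    linarith
  have ht : |X.2 - Y.2 - (1 / 2) * area Y.1 X.1| ≤ hdist X Y := by
    have := sq_nonneg ‖X.1 - Y.1‖
    nlinarith
  have hω : |area Y.1 X.1| ≤ 2 * M * hdist X Y := by
    have : area Y.1 X.1 = area Y.1 (X.1 - Y.1) := by
      simp only [area, PiLp.sub_apply]; ring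
    rw [this]
    refine (abs_area_le _ _).trans ?_
    gcongr
  have hs : |X.2 - Y.2| ≤ (1 + M) * hdist X Y := by
    have : X.2 - Y.2 = (X.2 - Y.2 - (1 / 2) * area Y.1 X.1) + (1 / 2) * area Y.1 X.1 := by ring
    rw [this]
    refine (abs_add_le _ _).trans ?_
    rw [abs_mul, abs_of_pos (by norm_num : (0 : ℝ) < 1 / 2)]
    linarith
  rw [Prod.dist_eq, dist_eq_norm, Real.dist_eq]
  refine max_le ?_ ?_
  · nlinarith
  · linarith

/-- At gauge distance at most 1, `dist_le_hdist` applies around a point of the bounded support;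
beyond that, boundedness of `f` suffices. -/
theorem exists_abs_sub_le_hdist {f : Heis → ℝ} {C : NNReal} (hf : LipschitzWith C f)
    (hs : HasCompactSupport f) : ∃ K : ℝ, ∀ X Y : Heis, |f X - f Y| ≤ K * hdist X Y := by
  obtain ⟨B, hB⟩ := hs.exists_bound_of_continuous hf.continuous
  obtain ⟨M, hM⟩ := hs.isBounded.exists_norm_le
  have hB0 : 0 ≤ B := (norm_nonneg _).trans (hB 0)
  have hM' : ∀ X, f X ≠ 0 → ‖X.1‖ ≤ max M 0 := fun X hX =>
    ((norm_fst_le X).trans (hM X (subset_tsupport f hX))).trans (le_max_left _ _)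
  have hm0 : 0 ≤ max M 0 := le_max_right _ _
  refine ⟨2 * B + C * (2 + max M 0), fun X Y => ?_⟩
  have h0 := hdist_nonneg X Y
  have hCM : 0 ≤ C * (2 + max M 0) := by positivity
  rcases le_total (hdist X Y) 1 with h1 | h1
  · by_cases hfX : f X = 0
    · by_cases hfY : f Y = 0
      · rw [hfX, hfY, sub_zero, abs_zero]
        positivity
      · have h2 := dist_le_hdist (hM' Y hfY) h1
        calc |f X - f Y| ≤ C * dist X Y := hf.dist_le_mul X Y
          _ ≤ C * ((2 + max M 0) * hdist X Y) := by gcongr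
          _ ≤ _ := by nlinarith
    · have h2 := dist_le_hdist (hM' X hfX) (hdist_comm X Y ▸ h1)
      rw [dist_comm, hdist_comm] at h2
      calc |f X - f Y| ≤ C * dist X Y := hf.dist_le_mul X Y
          _ ≤ C * ((2 + max M 0) * hdist X Y) := by gcongr
          _ ≤ _ := by nlinarith
  · calc |f X - f Y| ≤ |f X| + |f Y| := abs_sub _ _
      _ ≤ B + B := add_le_add (hB X) (hB Y)
      _ ≤ _ := by nlinarith

/-- The reflection `(X, t) ↦ (-X, t)`. -/
def flip : Heis ≃ₜ Heis := (Homeomorph.neg _).prodCongr (Homeomorph.refl ℝ)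

theorem flip_apply (Z : Heis) : flip Z = (-Z.1, Z.2) := rfl

theorem isometry_flip : Isometry flip := fun X Y => by
  rw [flip_apply, flip_apply, Prod.edist_eq, Prod.edist_eq, edist_neg_neg]

theorem isOddLip_sub_flip {f : Heis → ℝ} {C : NNReal} (hf : LipschitzWith C f)
    (hs : HasCompactSupport f) : IsOddLip fun Z => f Z - f (flip Z) := by
  have hs' : HasCompactSupport fun Z => f (flip Z) := hs.comp_homeomorph flip
  have hsd : HasCompactSupport fun Z => f Z - f (flip Z) := by
    simpa only [sub_eq_add_neg] using! hs.add hs'.neg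
  have hf' : LipschitzWith (C * 1) fun Z => f (flip Z) := hf.comp isometry_flip.lipschitz
  refine ⟨exists_abs_sub_le_hdist (hf.sub hf') hsd, hsd, fun x t => ?_⟩
  simp [flip_apply]

theorem continuous_coord (i : Fin 2) : Continuous fun X : Heis => X.1 i :=
  (EuclideanSpace.proj (𝕜 := ℝ) i).continuous.comp continuous_fst

/-- The homeomorphism `Y ↦ Y⁻¹ · X`. -/
noncomputable def invMul (X : Heis) : Heis ≃ₜ Heis where
  toFun Y := mul (inv Y) X
  invFun Z := mul X (inv Z)
  left_inv Y := by
    refine Prod.ext ?_ ?_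
    · simp [mul, inv]
    · simp [mul, inv]; ring
  right_inv Z := by
    refine Prod.ext ?_ ?_
    · simp [mul, inv]
    · simp [mul, inv]; ring
  continuous_toFun := by
    have h0 := continuous_coord 0
    have h1 := continuous_coord 1
    simp only [mul, inv, PiLp.neg_apply]
    fun_prop
  continuous_invFun := by
    have h0 := continuous_coord 0
    have h1 := continuous_coord 1
    simp only [mul, inv, PiLp.neg_apply]
    fun_prop

theorem invMul_reflect (X Y : Heis) : invMul X (reflect X.1 Y) = flip (invMul X Y) := by
  refine Prod.ext ?_ ?_
  · simp [invMul, mul, inv, reflect, flip_apply]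
    abel
  · simp [invMul, mul, inv, reflect, flip_apply, area]; ring

theorem continuous_reflect (x : EuclideanSpace ℝ (Fin 2)) : Continuous (reflect x) := by
  have h0 := continuous_coord 0
  have h1 := continuous_coord 1
  unfold reflect area
  fun_prop

/-- A vampiric measure is invariant under the reflections at the points of its support. -/
theorem IsVampiric.map_reflect {μ : Measure Heis} [IsLocallyFiniteMeasure μ]
    (hμ : IsVampiric μ) {X : Heis} (hX : X ∈ μ.support) : μ.map (reflect X.1) = μ := by
  have hc1 : IsFiniteMeasureOnCompacts (μ.map (invMul X)) :=
    Measure.IsFiniteMeasureOnCompacts.map μ _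
  have hc2 : IsFiniteMeasureOnCompacts ((μ.map (invMul X)).map flip) :=
    Measure.IsFiniteMeasureOnCompacts.map _ _
  -- Every Lipschitz `f` of compact support has an admissible antisymmetrization, whose vanishing
  -- integral is the equality of the two integrals of `f`.
  have key : (μ.map (invMul X)).map flip = μ.map (invMul X) := by
    refine measure_ext_of_integral_lipschitz fun f C hf hs => ?_
    have hs' : HasCompactSupport fun Z => f (flip Z) := hs.comp_homeomorph flip
    have hf' : Continuous fun Z => f (flip Z) := hf.continuous.comp flip.continuous
    have h := hμ _ (isOddLip_sub_flip hf hs) X hX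
    rw [flip.measurableEmbedding.integral_map, (invMul X).measurableEmbedding.integral_map,
      (invMul X).measurableEmbedding.integral_map]
    have i1 : Integrable (fun Y => f (invMul X Y)) μ :=
      (hf.continuous.comp (invMul X).continuous).integrable_of_hasCompactSupport
        (hs.comp_homeomorph (invMul X))
    have i2 : Integrable (fun Y => f (flip (invMul X Y))) μ :=
      (hf'.comp (invMul X).continuous).integrable_of_hasCompactSupport
        (hs'.comp_homeomorph (invMul X))
    have h' : ∫ Y, (f (invMul X Y) - f (flip (invMul X Y))) ∂μ = 0 := h
    rw [integral_sub i1 i2] at h'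
    linarith
  have e : (μ.map (reflect X.1)).map (invMul X) = μ.map (invMul X) := by
    rw [← key, Measure.map_map (invMul X).measurable (continuous_reflect _).measurable,
      Measure.map_map flip.measurable (invMul X).measurable]
    congr 1
    ext1 Y
    exact invMul_reflect X Y
  have := congrArg (Measure.map (invMul X).symm) e
  rwa [Measure.map_map (invMul X).symm.measurable (invMul X).measurable,
    Measure.map_map (invMul X).symm.measurable (invMul X).measurable,
    Homeomorph.symm_comp_self, Measure.map_id, Measure.map_id] at this

end Heis

theorem mem_support_of_map_eq {α : Type*} [TopologicalSpace α] [MeasurableSpace α]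
    [BorelSpace α] {μ : Measure α} {h : α → α} (hc : Continuous h)
    (hμ : μ.map h = μ) {x : α} (hx : x ∈ μ.support) : h x ∈ μ.support := by
  rw [Measure.support_eq_forall_isOpen] at hx ⊢
  intro U hU hUo
  rw [← hμ, Measure.map_apply hc.measurable hUo.measurableSet]
  exact hx _ hU (hUo.preimage hc)

/-! ### Left translations preserving the measure -/

namespace Heis

theorem mul_fst (X Y : Heis) : (mul X Y).1 = X.1 + Y.1 := rfl

theorem mul_snd (X Y : Heis) : (mul X Y).2 = X.2 + Y.2 + (1 / 2) * area X.1 Y.1 := rfl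

theorem inv_fst (X : Heis) : (inv X).1 = -X.1 := rfl

theorem inv_snd (X : Heis) : (inv X).2 = -X.2 := rfl

theorem area_add_left (a b c : EuclideanSpace ℝ (Fin 2)) :
    area (a + b) c = area a c + area b c := by simp [area]; ring

theorem area_add_right (a b c : EuclideanSpace ℝ (Fin 2)) :
    area a (b + c) = area a b + area a c := by simp [area]; ring

theorem area_neg_left (a b : EuclideanSpace ℝ (Fin 2)) : area (-a) b = -area a b := by
  simp [area]; ring

theorem area_neg_right (a b : EuclideanSpace ℝ (Fin 2)) : area a (-b) = -area a b := by
  simp [area]; ring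

theorem area_smul_left (r : ℝ) (a b : EuclideanSpace ℝ (Fin 2)) :
    area (r • a) b = r * area a b := by simp [area]; ring

theorem area_smul_right (r : ℝ) (a b : EuclideanSpace ℝ (Fin 2)) :
    area a (r • b) = r * area a b := by simp [area]; ring

theorem area_self (a : EuclideanSpace ℝ (Fin 2)) : area a a = 0 := by
  simp [area]; ring

theorem area_zero_left (a : EuclideanSpace ℝ (Fin 2)) : area 0 a = 0 := by simp [area]

theorem area_zero_right (a : EuclideanSpace ℝ (Fin 2)) : area a 0 = 0 := by simp [area]

theorem area_swap (a b : EuclideanSpace ℝ (Fin 2)) : area b a = -area a b := by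
  simp [area]; ring

theorem mul_assoc (X Y Z : Heis) : mul (mul X Y) Z = mul X (mul Y Z) := by
  refine Prod.ext ?_ ?_
  · simp only [mul_fst, add_assoc]
  · simp only [mul_fst, mul_snd, area_add_left, area_add_right]; ring

theorem inv_mul_cancel_left (X Y : Heis) : mul (inv X) (mul X Y) = Y := by
  refine Prod.ext ?_ ?_
  · simp [mul_fst, inv_fst]
  · simp [mul_fst, mul_snd, inv_fst, inv_snd, area_neg_left, area_add_right, area_self]
    ring

theorem continuous_mul_left (g : Heis) : Continuous (mul g) := by
  have h0 := continuous_coord 0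
  have h1 := continuous_coord 1
  unfold mul
  fun_prop

/-- The left translation by `g` preserves `μ`. -/
def Fixes (μ : Measure Heis) (g : Heis) : Prop := μ.map (mul g) = μ

variable {μ : Measure Heis}

theorem Fixes.mul {g h : Heis} (hg : Fixes μ g) (hh : Fixes μ h) : Fixes μ (mul g h) := by
  have : Heis.mul (Heis.mul g h) = Heis.mul g ∘ Heis.mul h := funext fun Z => mul_assoc g h Z
  rw [Fixes, this, ← Measure.map_map (continuous_mul_left _).measurable
    (continuous_mul_left _).measurable, hh, hg]

theorem Fixes.inv {g : Heis} (hg : Fixes μ g) : Fixes μ (inv g) := by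
  have : Heis.mul (Heis.inv g) ∘ Heis.mul g = id := funext fun Z => inv_mul_cancel_left g Z
  calc μ.map (Heis.mul (Heis.inv g)) = (μ.map (Heis.mul g)).map (Heis.mul (Heis.inv g)) := by
        rw [hg]
    _ = μ := by
        rw [Measure.map_map (continuous_mul_left _).measurable
          (continuous_mul_left _).measurable, this, Measure.map_id]

theorem fixes_zero : Fixes μ 0 := by
  have : Heis.mul 0 = id := by
    ext1 Z
    refine Prod.ext ?_ ?_
    · simp [mul_fst]
    · simp [mul_snd, area_zero_left]
  rw [Fixes, this, Measure.map_id]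

theorem Fixes.mem_support {g X : Heis} (hg : Fixes μ g) (hX : X ∈ μ.support) :
    Heis.mul g X ∈ μ.support := mem_support_of_map_eq (continuous_mul_left g) hg hX

theorem Fixes.measure_preimage {g : Heis} (hg : Fixes μ g) {U : Set Heis} (hU : MeasurableSet U) :
    μ (Heis.mul g ⁻¹' U) = μ U := by
  rw [← Measure.map_apply (continuous_mul_left g).measurable hU, hg]

theorem Fixes.nsmul_horizontal {a : EuclideanSpace ℝ (Fin 2)} (ha : Fixes μ (a, 0)) (n : ℕ) :
    Fixes μ ((n : ℝ) • a, 0) := by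
  induction n with
  | zero =>
    simp only [Nat.cast_zero, zero_smul]
    exact fixes_zero
  | succ n ih =>
    convert! ih.mul ha using 1
    refine Prod.ext ?_ ?_
    · simp [mul_fst, add_smul]
    · simp [mul_snd, area_smul_left, area_self]

theorem Fixes.nsmul_vertical {w : ℝ} (hw : Fixes μ (0, w)) (n : ℕ) :
    Fixes μ (0, (n : ℝ) * w) := by
  induction n with
  | zero =>
    simp only [Nat.cast_zero, zero_mul]
    exact fixes_zero
  | succ n ih =>
    convert! ih.mul hw using 1
    refine Prod.ext ?_ ?_
    · simp [mul_fst]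
    · simp [mul_snd, area_zero_left]; ring

theorem Fixes.commutator {a b : EuclideanSpace ℝ (Fin 2)} (ha : Fixes μ (a, 0))
    (hb : Fixes μ (b, 0)) : Fixes μ (0, area a b) := by
  convert! (ha.mul hb).mul (ha.inv.mul hb.inv) using 1
  refine Prod.ext ?_ ?_
  · simp only [mul_fst, inv_fst]
    abel
  · simp [mul_fst, mul_snd, inv_fst, inv_snd, area_add_left, area_add_right, area_neg_left,
      area_neg_right, area_self]
    rw [area_swap a b]
    ring

/-- Normal form in the group generated by `(a, 0)` and `(b, 0)`: `k` counts commutators, and `1 / 2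
* i * j` is the twist of the product of the two horizontal powers. -/
theorem Fixes.lattice {a b : EuclideanSpace ℝ (Fin 2)} (ha : Fixes μ (a, 0))
    (hb : Fixes μ (b, 0)) (i j k : ℕ) :
    Fixes μ ((i : ℝ) • a + (j : ℝ) • b, (1 / 2 * i * j + k) * area a b) := by
  convert! ((ha.commutator hb).nsmul_vertical k).mul
    ((ha.nsmul_horizontal i).mul (hb.nsmul_horizontal j)) using 1
  refine Prod.ext ?_ ?_
  · simp [mul_fst]
  · simp [mul_fst, mul_snd, area_zero_left, area_smul_left, area_smul_right]
    ring

theorem IsVampiric.fixes [IsLocallyFiniteMeasure μ] (hμ : IsVampiric μ) (h0 : 0 ∈ μ.support)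
    {X : Heis} (hX : X ∈ μ.support) : Fixes μ (X.1 + X.1, 0) := by
  have : mul (X.1 + X.1, 0) = reflect X.1 ∘ reflect 0 := by
    ext1 Y
    refine Prod.ext ?_ ?_
    · simp [mul_fst, reflect]
    · simp [mul_snd, reflect, area_zero_left, area_neg_right, area_add_left]; ring
  have e0 : μ.map (reflect 0) = μ := hμ.map_reflect h0
  rw [Fixes, this, ← Measure.map_map (continuous_reflect _).measurable
    (continuous_reflect _).measurable, e0, hμ.map_reflect hX]

theorem distDiam_eq_top {S : Set Heis} (h0 : (0 : Heis) ∈ S)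
    (h : ∀ R : ℝ, ∃ X ∈ S, R ≤ gauge X) : distDiam hdist S = ⊤ := by
  refine ENNReal.eq_top_of_forall_nnreal_le fun r => ?_
  obtain ⟨X, hX, hr⟩ := h r
  have h1 : (r : ENNReal) ≤ ENNReal.ofReal (hdist X 0) := by
    rw [← ENNReal.ofReal_coe_nnreal, hdist_zero_right]
    exact ENNReal.ofReal_le_ofReal hr
  exact h1.trans (le_iSup₂_of_le X hX (le_iSup₂_of_le 0 h0 le_rfl))

theorem norm_fst_le_gauge (X : Heis) : ‖X.1‖ ≤ gauge X :=
  Real.le_sqrt_of_sq_le (by linarith [abs_nonneg X.2])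

theorem Fixes.distDiam_support {a : EuclideanSpace ℝ (Fin 2)} (ha : Fixes μ (a, 0)) (ha0 : a ≠ 0)
    (h0 : (0 : Heis) ∈ μ.support) : distDiam hdist μ.support = ⊤ := by
  refine distDiam_eq_top h0 fun R => ?_
  have hn := norm_pos_iff.2 ha0
  obtain ⟨n, hn'⟩ := exists_nat_ge (R / ‖a‖)
  refine ⟨_, (ha.nsmul_horizontal n).mem_support h0, le_trans ?_ (norm_fst_le_gauge _)⟩
  rw [div_le_iff₀ hn] at hn'
  simpa [mul_fst, norm_smul] using hn'

/-! ### Lattice growth of order 4 -/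

theorem _root_.Nat.eq_of_abs_sub_mul_lt {i j : ℕ} {s w : ℝ} (hi : |s - i * w| < |w| / 2)
    (hj : |s - j * w| < |w| / 2) : i = j := by
  have hw : 0 < |w| := by linarith [abs_nonneg (s - i * w)]
  have h1 : |((i : ℝ) - j) * w| < |w| := by
    calc |((i : ℝ) - j) * w| = |(s - j * w) - (s - i * w)| := by congr 1; ring
      _ ≤ |s - j * w| + |s - i * w| := abs_sub _ _
      _ < |w| := by linarith
  rw [abs_mul] at h1
  have h2 : |((i : ℝ) - j)| < 1 := by
    by_contra! h
    nlinarith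
  have h3 : |((i : ℤ) - j)| < 1 := by exact_mod_cast h2
  have := Int.abs_lt_one_iff.1 h3
  omega

/-- The fundamental domain of the lattice generated by `(a, 0)` and `(b, 0)`. -/
def cell (a b : EuclideanSpace ℝ (Fin 2)) : Set Heis :=
  {u | |area u.1 b| < |area a b| / 2 ∧ |area a u.1| < |area a b| / 2 ∧
    |u.2| < |area a b| / 2 ∧ ‖u.1‖ < 1}

theorem isOpen_cell (a b : EuclideanSpace ℝ (Fin 2)) : IsOpen (cell a b) := by
  have h0 := continuous_coord 0
  have h1 := continuous_coord 1
  have c1 : Continuous fun u : Heis => |area u.1 b| := by unfold area; fun_prop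
  have c2 : Continuous fun u : Heis => |area a u.1| := by unfold area; fun_prop
  have c3 : Continuous fun u : Heis => |u.2| := by fun_prop
  have c4 : Continuous fun u : Heis => ‖u.1‖ := by fun_prop
  exact (isOpen_lt c1 continuous_const).inter ((isOpen_lt c2 continuous_const).inter
    ((isOpen_lt c3 continuous_const).inter (isOpen_lt c4 continuous_const)))

/-- Parabolic scaling: vertical size `N ^ 2` corresponds to gauge `N`, so `k` ranges up to `N ^ 2`
and `N ^ 4` translates fit in a ball of radius comparable to `N`. -/
theorem gauge_mul_lt {a b : EuclideanSpace ℝ (Fin 2)} {u : Heis} (hu : u ∈ cell a b)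
    {i j k N : ℕ} (hi : i < N) (hj : j < N) (hk : k < N ^ 2) :
    gauge (mul ((i : ℝ) • a + (j : ℝ) • b, (1 / 2 * i * j + k) * area a b) u) <
      N * (‖a‖ + ‖b‖ + 1 + |area a b| + 1) := by
  obtain ⟨-, -, hu2, hu1⟩ := hu
  have hi' : (i : ℝ) ≤ N := by exact_mod_cast hi.le
  have hj' : (j : ℝ) ≤ N := by exact_mod_cast hj.le
  have hk' : (k : ℝ) ≤ (N : ℝ) ^ 2 := by exact_mod_cast hk.le
  have hN : (1 : ℝ) ≤ N := by exact_mod_cast Nat.one_le_of_lt hi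
  have hi0 : (0 : ℝ) ≤ i := Nat.cast_nonneg i
  have hj0 : (0 : ℝ) ≤ j := Nat.cast_nonneg j
  have ha := norm_nonneg a
  have hb := norm_nonneg b
  set w := |area a b| with hw
  have hw0 : 0 ≤ w := abs_nonneg _
  set M := ‖a‖ + ‖b‖ + 1 with hM
  have hM1 : 1 ≤ M := by linarith
  set p : EuclideanSpace ℝ (Fin 2) := (i : ℝ) • a + (j : ℝ) • b with hp
  have hpn : ‖p‖ ≤ N * (‖a‖ + ‖b‖) := by
    refine (norm_add_le _ _).trans ?_
    rw [norm_smul, norm_smul, Real.norm_natCast, Real.norm_natCast]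
    nlinarith
  have h1 : ‖p + u.1‖ ≤ N * M := by
    refine (norm_add_le _ _).trans ?_
    rw [hM]
    nlinarith
  have h2 : |(1 / 2 * i * j + k) * area a b + u.2 + 1 / 2 * area p u.1| ≤
      (N : ℝ) ^ 2 * (2 * w + M) := by
    have hij : (i : ℝ) * j ≤ (N : ℝ) ^ 2 := by nlinarith
    have e1 : |(1 / 2 * i * j + k) * area a b| ≤ 3 / 2 * (N : ℝ) ^ 2 * w := by
      rw [abs_mul, abs_of_nonneg (by positivity)]
      gcongr
      linarith
    have e2 : |1 / 2 * area p u.1| ≤ (N : ℝ) ^ 2 * M := by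
      rw [abs_mul, abs_of_pos (by norm_num : (0 : ℝ) < 1 / 2)]
      have := abs_area_le p u.1
      have h3 : ‖p‖ * ‖u.1‖ ≤ N * (‖a‖ + ‖b‖) * 1 := by gcongr
      have h4 : (N : ℝ) * (‖a‖ + ‖b‖) ≤ N ^ 2 * M := by
        have : (N : ℝ) ≤ N ^ 2 := by nlinarith
        have : ‖a‖ + ‖b‖ ≤ M := by linarith
        gcongr
      linarith
    have e3 : w / 2 ≤ 1 / 2 * (N : ℝ) ^ 2 * w := by
      have := le_mul_of_one_le_left hw0 (one_le_pow₀ hN (n := 2))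
      linarith
    refine (abs_add_le _ _).trans ?_
    have := abs_add_le ((1 / 2 * i * j + k) * area a b) u.2
    linarith
  rw [gauge, mul_fst, mul_snd]
  refine (Real.sqrt_lt' (by positivity)).2 ?_
  calc ‖p + u.1‖ ^ 2 + |(1 / 2 * i * j + k) * area a b + u.2 + 1 / 2 * area p u.1|
      ≤ (N * M) ^ 2 + (N : ℝ) ^ 2 * (2 * w + M) := by gcongr
    _ = (N : ℝ) ^ 2 * (M ^ 2 + 2 * w + M) := by ring
    _ < (N : ℝ) ^ 2 * (M + w + 1) ^ 2 := by
        refine mul_lt_mul_of_pos_left ?_ (by positivity)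
        nlinarith
    _ = _ := by ring

/-- If the left translations by `(a, 0)` and `(b, 0)`, with `a` and `b` linearly independent,
preserve `μ`, then `μ` has growth of order `4` and cannot be `3`-regular. -/
theorem IsADR.area_eq_zero {C : ℝ} (hC : IsADR hdist 3 C μ) (h0 : (0 : Heis) ∈ μ.support)
    {a b : EuclideanSpace ℝ (Fin 2)} (ha : Fixes μ (a, 0)) (hb : Fixes μ (b, 0)) :
    area a b = 0 := by
  by_contra hab
  have ha0 : a ≠ 0 := by
    rintro rfl
    exact hab (area_zero_left b)
  have hdiam := ha.distDiam_support ha0 h0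
  have hw : 0 < |area a b| := abs_pos.2 hab
  have hU0 : 0 < μ (cell a b) := by
    refine (Measure.mem_support_iff_forall _).1 h0 _ ((isOpen_cell a b).mem_nhds ?_)
    simp [cell, area_zero_left, area_zero_right, hab]
  set K := ‖a‖ + ‖b‖ + 1 + |area a b| + 1 with hK
  have hK0 : 0 < K := by positivity
  set p : ℕ × ℕ × ℕ → Heis := fun q =>
    ((q.1 : ℝ) • a + (q.2.1 : ℝ) • b, (1 / 2 * q.1 * q.2.1 + q.2.2) * area a b) with hp
  have hpfix : ∀ q, Fixes μ (inv (p q)) := fun q => (ha.lattice hb q.1 q.2.1 q.2.2).inv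
  set V : ℕ × ℕ × ℕ → Set Heis := fun q => mul (inv (p q)) ⁻¹' cell a b with hV
  have hVm : ∀ q, MeasurableSet (V q) := fun q =>
    ((isOpen_cell a b).preimage (continuous_mul_left _)).measurableSet
  have hVμ : ∀ q, μ (V q) = μ (cell a b) := fun q =>
    (hpfix q).measure_preimage (isOpen_cell a b).measurableSet
  have hdisj : ∀ q q' : ℕ × ℕ × ℕ, q ≠ q' → Disjoint (V q) (V q') := by
    intro q q' hne
    rw [Set.disjoint_left]
    rintro Y ⟨hY1, hY2, hY3, -⟩ ⟨hY1', hY2', hY3', -⟩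
    refine hne ?_
    obtain ⟨i, j, k⟩ := q
    obtain ⟨i', j', k'⟩ := q'
    simp only [hp, mul_fst, mul_snd, inv_fst, inv_snd, area_add_left, area_add_right,
      area_neg_left, area_neg_right, area_smul_left, area_smul_right, area_self]
      at hY1 hY2 hY3 hY1' hY2' hY3'
    -- The translates separate triangularly: pairing with `b` determines `i`, pairing with `a`
    -- determines `j`, and then the vertical coordinate determines `k`.
    have hi : i = i' := by
      refine Nat.eq_of_abs_sub_mul_lt (s := area Y.1 b) (w := area a b) ?_ ?_
      · convert hY1 using 2; ring
      · convert hY1' using 2; ring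
    have hj : j = j' := by
      refine Nat.eq_of_abs_sub_mul_lt (s := area a Y.1) (w := area a b) ?_ ?_
      · convert hY2 using 2; ring
      · convert hY2' using 2; ring
    subst hi hj
    have hk : k = k' := by
      refine Nat.eq_of_abs_sub_mul_lt (s := Y.2 - 1 / 2 * i * j * area a b -
        1 / 2 * (i * area a Y.1 + j * area b Y.1)) (w := area a b) ?_ ?_
      · convert hY3 using 2; ring
      · convert hY3' using 2; ring
    rw [hk]
  have hcount : ∀ N : ℕ, 0 < N →
      ((N : ENNReal) ^ 4) * μ (cell a b) ≤ ENNReal.ofReal (C * (N * K) ^ 3) := by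
    intro N hN
    set s := Finset.range N ×ˢ Finset.range N ×ˢ Finset.range (N ^ 2) with hs
    have hsub : ⋃ q ∈ s, V q ⊆ {Y | hdist Y 0 < N * K} := by
      refine Set.iUnion₂_subset fun q hq Y hY => ?_
      simp only [hs, Finset.mem_product, Finset.mem_range] at hq
      have hlt := gauge_mul_lt hY hq.1 hq.2.1 hq.2.2
      have e : mul (p q) (mul (inv (p q)) Y) = Y := by
        have := inv_mul_cancel_left (inv (p q)) Y
        simpa [inv] using this
      rw [Set.mem_ofPred_eq, hdist_zero_right]
      exact e ▸ hlt
    have hN' : (0 : ℝ) < N := by exact_mod_cast hN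
    calc (N : ENNReal) ^ 4 * μ (cell a b) = ∑ q ∈ s, μ (V q) := by
          simp only [hVμ, Finset.sum_const, nsmul_eq_mul]
          congr 1
          simp only [hs, Finset.card_product, Finset.card_range]
          push_cast
          ring
      _ = μ (⋃ q ∈ s, V q) :=
          (measure_biUnion_finset (fun q _ q' _ h => hdisj q q' h) fun q _ => hVm q).symm
      _ ≤ μ {Y | hdist Y 0 < N * K} := measure_mono hsub
      _ ≤ _ := (hC.2 0 h0 (N * K) (by positivity) (by rw [hdiam]; exact ENNReal.ofReal_lt_top)).2
  have hC0 := hC.1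
  -- The case `N = 1` of the count already bounds the mass of one cell.
  have hfin : μ (cell a b) ≠ ⊤ := by
    have := hcount 1 one_pos
    simp only [Nat.cast_one, one_pow, one_mul] at this
    exact (this.trans_lt ENNReal.ofReal_lt_top).ne
  have hm : 0 < μ.real (cell a b) := ENNReal.toReal_pos hU0.ne' hfin
  obtain ⟨N, hN⟩ := exists_nat_gt (C * K ^ 3 / μ.real (cell a b))
  have hN0 : (0 : ℝ) < N := lt_of_le_of_lt (by positivity) hN
  rw [div_lt_iff₀ hm] at hN
  have h1 := ENNReal.toReal_mono ENNReal.ofReal_ne_top (hcount N (by exact_mod_cast hN0))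
  rw [ENNReal.toReal_mul, ENNReal.toReal_ofReal (by positivity), ENNReal.toReal_pow,
    ENNReal.toReal_natCast] at h1
  have h2 : (N : ℝ) ^ 3 * (C * K ^ 3) < (N : ℝ) ^ 3 * (N * μ.real (cell a b)) :=
    mul_lt_mul_of_pos_left hN (by positivity)
  have h3 : μ.real (cell a b) = (μ (cell a b)).toReal := rfl
  rw [h3] at h2
  nlinarith

/-! ### Vertical lines are null -/

theorem eq_of_hdist_eq_zero {X Y : Heis} (h : hdist X Y = 0) : X = Y := by
  have h1 := hdist_sq X Y
  rw [h] at h1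
  have h2 := abs_nonneg (X.2 - Y.2 - (1 / 2) * area Y.1 X.1)
  have h3 : ‖X.1 - Y.1‖ = 0 := by
    have := sq_nonneg ‖X.1 - Y.1‖
    refine pow_eq_zero_iff two_ne_zero |>.1 (by linarith)
  have h4 : X.1 = Y.1 := sub_eq_zero.1 (norm_eq_zero.1 h3)
  refine Prod.ext h4 ?_
  rw [h4, area_self, sub_self, norm_zero] at h1
  have h5 : |X.2 - Y.2| = 0 := by simpa using h1.symm
  exact sub_eq_zero.1 (abs_eq_zero.1 h5)

theorem hdist_of_fst_eq {X Y : Heis} (h : X.1 = Y.1) : hdist X Y = Real.sqrt |X.2 - Y.2| := by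
  rw [hdist_eq, h, area_self]
  simp

/-- Vertical lines have parabolic dimension `2`, hence are null for a `3`-regular measure. -/
theorem IsADR.measure_vertical_line {C : ℝ} (hC : IsADR hdist 3 C μ)
    (hμ : μ.support.Nontrivial) (z : EuclideanSpace ℝ (Fin 2)) : μ (Prod.fst ⁻¹' {z}) = 0 := by
  obtain ⟨X, hX, Y, hY, hXY⟩ := hμ
  have hC0 := hC.1
  set δ := hdist X Y with hδ
  have hδ0 : 0 < δ := lt_of_le_of_ne (hdist_nonneg X Y)
    fun h => hXY (eq_of_hdist_eq_zero h.symm)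
  have hdiam : ENNReal.ofReal δ ≤ distDiam hdist μ.support :=
    le_iSup₂_of_le X hX (le_iSup₂_of_le Y hY le_rfl)
  -- Cut a unit segment into `m ^ 2` pieces of height `m⁻²`. A piece of positive mass lies in a ball
  -- of radius `2 / m` about one of its support points, so the total is at most `m ^ 2 * C * (2 / m)
  -- ^ 3`. The bound on `m` keeps the radius below the diameter.
  have key : ∀ (n : ℤ) (m : ℕ), 2 / δ < m →
      μ {Y | Y.1 = z ∧ (n : ℝ) ≤ Y.2 ∧ Y.2 < n + 1} ≤ ENNReal.ofReal (8 * C / m) := by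
    intro n m hm
    have hm0 : (0 : ℝ) < m := lt_trans (by positivity) hm
    have hr : 2 / (m : ℝ) < δ := by
      rw [div_lt_iff₀ hδ0] at hm
      rw [div_lt_iff₀ hm0]
      linarith
    set I : ℕ → Set Heis := fun k =>
      {Y | Y.1 = z ∧ (k : ℝ) ≤ (Y.2 - n) * m ^ 2 ∧ (Y.2 - n) * m ^ 2 < k + 1} with hI
    have hpiece : ∀ k, μ (I k) ≤ ENNReal.ofReal (C * (2 / m) ^ 3) := by
      intro k
      rcases eq_or_ne (μ (I k)) 0 with h0 | h0
      · rw [h0]; exact zero_le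
      · obtain ⟨e, he, hes⟩ := Measure.nonempty_inter_support_of_pos (pos_iff_ne_zero.2 h0)
        refine (measure_mono fun W hW => ?_).trans
          (hC.2 e hes (2 / m) (by positivity)
            (((ENNReal.ofReal_lt_ofReal_iff hδ0).2 hr).trans_le hdiam)).2
        obtain ⟨e1, e2, e3⟩ := he
        obtain ⟨w1, w2, w3⟩ := hW
        rw [Set.mem_ofPred_eq, hdist_of_fst_eq (w1.trans e1.symm)]
        refine (Real.sqrt_lt' (by positivity)).2 ?_
        have : |W.2 - e.2| * (m : ℝ) ^ 2 ≤ 1 := by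
          rw [← abs_of_pos (by positivity : (0 : ℝ) < m ^ 2), ← abs_mul, abs_le]
          constructor <;> nlinarith
        rw [div_pow, lt_div_iff₀ (by positivity)]
        linarith
    calc μ {Y | Y.1 = z ∧ (n : ℝ) ≤ Y.2 ∧ Y.2 < n + 1}
        ≤ μ (⋃ k ∈ Finset.range (m ^ 2), I k) := by
          refine measure_mono ?_
          rintro W ⟨w1, w2, w3⟩
          have hnn : 0 ≤ (W.2 - n) * m ^ 2 := by
            have : 0 ≤ W.2 - n := by linarith
            positivity
          refine Set.mem_iUnion₂.2 ⟨⌊(W.2 - n) * m ^ 2⌋₊, ?_, w1, Nat.floor_le hnn,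
            Nat.lt_floor_add_one _⟩
          rw [Finset.mem_range, Nat.floor_lt hnn]
          push_cast
          have : (0 : ℝ) < m ^ 2 := by positivity
          nlinarith
      _ ≤ ∑ k ∈ Finset.range (m ^ 2), μ (I k) := measure_biUnion_finset_le _ _
      _ ≤ ∑ k ∈ Finset.range (m ^ 2), ENNReal.ofReal (C * (2 / m) ^ 3) :=
          Finset.sum_le_sum fun k _ => hpiece k
      _ = ENNReal.ofReal (8 * C / m) := by
          rw [Finset.sum_const, Finset.card_range, nsmul_eq_mul, ← ENNReal.ofReal_natCast,
            ← ENNReal.ofReal_mul (by positivity)]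
          congr 1
          push_cast
          field_simp
          norm_num
  have hslab : ∀ n : ℤ, μ {Y | Y.1 = z ∧ (n : ℝ) ≤ Y.2 ∧ Y.2 < n + 1} = 0 := by
    intro n
    have ht : Tendsto (fun m : ℕ => ENNReal.ofReal (8 * C / m)) atTop (𝓝 0) := by
      simpa using ENNReal.tendsto_ofReal (tendsto_const_div_atTop_nhds_zero_nat (8 * C))
    refine le_antisymm (ge_of_tendsto ht ?_) zero_le
    filter_upwards [(tendsto_natCast_atTop_atTop (R := ℝ)).eventually_gt_atTop (2 / δ)] with m hm
    exact key n m hm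
  refine measure_mono_null ?_ (measure_iUnion_null hslab)
  intro W hW
  exact Set.mem_iUnion.2 ⟨⌊W.2⌋, hW, Int.floor_le _, Int.lt_floor_add_one _⟩

end Heis

/-! ### Measures on a vertical plane and the converse -/

namespace Heis

/-- The plane `ℝ e × ℝ`, parametrized by `ℝ × ℝ`. -/
noncomputable def strip (e : EuclideanSpace ℝ (Fin 2)) (p : ℝ × ℝ) : Heis := (p.1 • e, p.2)

/-- The projection of the Heisenberg group to the coordinates of the plane `ℝ e × ℝ`. -/
noncomputable def coords (e : EuclideanSpace ℝ (Fin 2)) (X : Heis) : ℝ × ℝ := (inner ℝ e X.1, X.2)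

theorem continuous_strip (e : EuclideanSpace ℝ (Fin 2)) : Continuous (strip e) := by
  unfold strip
  fun_prop

theorem continuous_coords (e : EuclideanSpace ℝ (Fin 2)) : Continuous (coords e) := by
  unfold coords
  fun_prop

theorem coords_strip {e : EuclideanSpace ℝ (Fin 2)} (he : ‖e‖ = 1) (p : ℝ × ℝ) :
    coords e (strip e p) = p := by
  refine Prod.ext ?_ rfl
  simp [coords, strip, inner_smul_right, he]

theorem measurableEmbedding_strip {e : EuclideanSpace ℝ (Fin 2)} (he : ‖e‖ = 1) :
    MeasurableEmbedding (strip e) :=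
  (Function.LeftInverse.isClosedEmbedding (coords_strip he) (continuous_coords e)
    (continuous_strip e)).measurableEmbedding

theorem eq_inner_smul_of_area_eq_zero {e z : EuclideanSpace ℝ (Fin 2)} (he : ‖e‖ = 1)
    (h : area e z = 0) : z = (inner ℝ e z : ℝ) • e := by
  have h1 : e 0 ^ 2 + e 1 ^ 2 = 1 := by
    have := EuclideanSpace.real_norm_sq_eq e
    rw [he, Fin.sum_univ_two] at this
    linarith
  have h2 : (inner ℝ e z : ℝ) = e 0 * z 0 + e 1 * z 1 := by
    simp [PiLp.inner_apply, Fin.sum_univ_two]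
    ring
  rw [area] at h
  ext i
  rw [h2]
  fin_cases i
  · simp
    linear_combination (-z 0) * h1 - e 1 * h
  · simp
    linear_combination (-z 1) * h1 + e 0 * h

theorem strip_coords {e : EuclideanSpace ℝ (Fin 2)} (he : ‖e‖ = 1) {X : Heis}
    (h : area e X.1 = 0) : strip e (coords e X) = X :=
  Prod.ext (eq_inner_smul_of_area_eq_zero he h).symm rfl

theorem lineProd_span {e : EuclideanSpace ℝ (Fin 2)} (he : ‖e‖ = 1) (ν : Measure ℝ) [SFinite ν] :
    lineProd (Submodule.span ℝ {e}) ν = (volume.prod ν).map (strip e) := by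
  have hiso : Isometry fun r : ℝ => r • e :=
    Isometry.of_dist_eq fun r s => by
      rw [dist_eq_norm, ← sub_smul, norm_smul, he, mul_one, dist_eq_norm]
  have hr : Set.range (fun r : ℝ => r • e) = (Submodule.span ℝ {e} : Set _) := by
    ext z
    simp [Submodule.mem_span_singleton]
  have h1 := hiso.map_hausdorffMeasure (d := 1) (Or.inl zero_le_one)
  rw [hr, hausdorffMeasure_real] at h1
  rw [lineProd, ← h1]
  conv_lhs => rw [← Measure.map_id (μ := ν)]
  rw [Measure.map_prod_map _ _ hiso.continuous.measurable measurable_id]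
  rfl

theorem exists_norm_eq_one_span {L : Submodule ℝ (EuclideanSpace ℝ (Fin 2))}
    (hL : Module.finrank ℝ L = 1) : ∃ e, ‖e‖ = 1 ∧ L = Submodule.span ℝ {e} := by
  obtain ⟨⟨v, hvL⟩, hv0, hv⟩ := finrank_eq_one_iff'.1 hL
  have hv0' : v ≠ 0 := fun h => hv0 (Subtype.ext h)
  have hn : ‖v‖ ≠ 0 := norm_ne_zero_iff.2 hv0'
  refine ⟨‖v‖⁻¹ • v, norm_smul_inv_norm hv0', ?_⟩
  rw [Submodule.span_singleton_smul_eq (IsUnit.mk0 _ (inv_ne_zero hn))]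
  refine le_antisymm (fun w hw => ?_) (by simpa [Submodule.span_le] using hvL)
  obtain ⟨c, hc⟩ := hv ⟨w, hw⟩
  exact Submodule.mem_span_singleton.2 ⟨c, congrArg Subtype.val hc⟩

/-- Products of the length on a line and of an arbitrary vertical measure are vampiric. -/
theorem isVampiric_lineProd {L : Submodule ℝ (EuclideanSpace ℝ (Fin 2))}
    (hL : Module.finrank ℝ L = 1) (ν : Measure ℝ) [SFinite ν] : IsVampiric (lineProd L ν) := by
  obtain ⟨e, he, rfl⟩ := exists_norm_eq_one_span hL
  rw [lineProd_span he]
  intro ψ hψ X hX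
  have hcl : IsClosed {Y : Heis | area e Y.1 = 0} := by
    have h0 := continuous_coord 0
    have h1 := continuous_coord 1
    have : Continuous fun Y : Heis => area e Y.1 := by unfold area; fun_prop
    exact isClosed_eq this continuous_const
  have hXe : area e X.1 = 0 := by
    refine Measure.support_subset_of_isClosed hcl ?_ hX
    rw [mem_ae_map_iff (continuous_strip e).measurable.aemeasurable hcl.measurableSet]
    refine Filter.univ_mem' fun p => ?_
    simp [strip, area_smul_right, area_self]
  obtain ⟨⟨c, t⟩, rfl⟩ : ∃ p, strip e p = X := ⟨_, strip_coords he hXe⟩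
  rw [(measurableEmbedding_strip he).integral_map]
  set g : ℝ × ℝ → ℝ := fun p => ψ (mul (inv (strip e p)) (strip e (c, t))) with hg
  have hgval : ∀ p, g p = ψ ((c - p.1) • e, t - p.2) := by
    intro p
    simp only [hg]
    congr 1
    refine Prod.ext ?_ ?_
    · simp only [mul_fst, inv_fst, strip]
      module
    · simp only [mul_snd, inv_fst, inv_snd, strip, area_neg_left, area_smul_left,
        area_smul_right, area_self]
      ring
  -- The reflection of the horizontal coordinate about `c` preserves the product measure and changes
  -- the sign of the integrand.
  set σ : ℝ × ℝ ≃ₜ ℝ × ℝ := (Homeomorph.subLeft (c + c)).prodCongr (Homeomorph.refl ℝ) with hσ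
  have hσm : MeasurePreserving σ (volume.prod ν) (volume.prod ν) :=
    (Measure.measurePreserving_sub_left volume (c + c)).prod (MeasurePreserving.id ν)
  have hodd : ∀ p, g (σ p) = -g p := by
    intro p
    rw [hgval, hgval, ← hψ.2.2]
    congr 1
    refine Prod.ext ?_ rfl
    change (c - (c + c - p.1)) • e = -((c - p.1) • e)
    module
  have := hσm.integral_comp σ.measurableEmbedding g
  simp only [hodd, integral_neg] at this
  change ∫ p, g p ∂_ = 0
  linarith

variable {μ : Measure Heis}

/-! ### Dense periods and the product structure -/

theorem IsADR.not_countable_fst_image_support {C : ℝ} (hC : IsADR hdist 3 C μ)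
    (hμ : μ.support.Nontrivial) : ¬ (Prod.fst '' μ.support).Countable := by
  intro hS
  have h1 : μ (⋃ z ∈ Prod.fst '' μ.support, Prod.fst ⁻¹' {z}) = 0 :=
    (measure_biUnion_null_iff hS).2 fun z _ => IsADR.measure_vertical_line hC hμ z
  have h2 : μ (μ.support) = 0 := measure_mono_null
    (fun X hX => Set.mem_iUnion₂.2 ⟨X.1, Set.mem_image_of_mem _ hX, rfl⟩) h1
  have h3 : μ Set.univ = 0 := by
    rw [← Set.union_compl_self μ.support]
    exact measure_union_null h2 Measure.measure_compl_support
  rw [Measure.measure_univ_eq_zero.1 h3, Measure.support_zero] at hμ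
  exact hμ.nonempty.ne_empty rfl

/-- The horizontal translations in the direction `e` which preserve `μ`. -/
def periods (μ : Measure Heis) (e : EuclideanSpace ℝ (Fin 2)) : AddSubgroup ℝ where
  carrier := {r | Fixes μ (r • e, 0)}
  zero_mem' := by
    change Fixes μ ((0 : ℝ) • e, 0)
    rw [zero_smul]
    exact fixes_zero
  add_mem' {r s} hr hs := by
    change Fixes μ _
    convert! Fixes.mul hr hs using 1
    refine Prod.ext ?_ ?_
    · simp only [mul_fst, add_smul]
    · simp [mul_snd, area_smul_left, area_smul_right, area_self]
  neg_mem' {r} hr := by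
    change Fixes μ _
    convert! Fixes.inv hr using 1
    simp [Heis.inv]

theorem mem_periods {e : EuclideanSpace ℝ (Fin 2)} {r : ℝ} :
    r ∈ periods μ e ↔ Fixes μ (r • e, 0) := Iff.rfl

/-- A vampiric `3`-regular measure is supported in a vertical plane. -/
theorem IsVampiric.exists_area_eq_zero {C : ℝ} [IsLocallyFiniteMeasure μ] (hC : IsADR hdist 3 C μ)
    (hV : IsVampiric μ) (h0 : (0 : Heis) ∈ μ.support) (hμ : μ.support.Nontrivial) :
    ∃ e : EuclideanSpace ℝ (Fin 2), ‖e‖ = 1 ∧ ∀ X ∈ μ.support, area e X.1 = 0 := by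
  obtain ⟨X₀, hX₀, hne⟩ : ∃ X ∈ μ.support, X.1 ≠ 0 := by
    by_contra! h
    refine IsADR.not_countable_fst_image_support hC hμ
      ((Set.countable_singleton (0 : EuclideanSpace ℝ (Fin 2))).mono ?_)
    rintro _ ⟨X, hX, rfl⟩
    exact h X hX
  refine ⟨‖X₀.1‖⁻¹ • X₀.1, norm_smul_inv_norm hne, fun X hX => ?_⟩
  have := IsADR.area_eq_zero hC h0 (hV.fixes h0 hX₀) (hV.fixes h0 hX)
  rw [area_add_left, area_add_right] at this
  rw [area_smul_left, show area X₀.1 X.1 = 0 by linarith, mul_zero]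

theorem IsVampiric.dense_periods {C : ℝ} [IsLocallyFiniteMeasure μ] (hC : IsADR hdist 3 C μ)
    (hV : IsVampiric μ) (h0 : (0 : Heis) ∈ μ.support) (hμ : μ.support.Nontrivial)
    {e : EuclideanSpace ℝ (Fin 2)} (he : ‖e‖ = 1) (hs : ∀ X ∈ μ.support, area e X.1 = 0) :
    Dense (periods μ e : Set ℝ) := by
  -- Twice the `e`-coordinate of each support point is a period, so periods generated by `a` would
  -- confine these coordinates to the countable set of multiples of `a / 2`.
  refine (periods μ e).dense_or_cyclic.resolve_right ?_
  rintro ⟨a, ha⟩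
  refine IsADR.not_countable_fst_image_support hC hμ
    ((Set.countable_range fun n : ℤ => ((n : ℝ) * a / 2) • e).mono ?_)
  rintro _ ⟨X, hX, rfl⟩
  have hXe := eq_inner_smul_of_area_eq_zero he (hs X hX)
  have hp : (inner ℝ e X.1 : ℝ) + inner ℝ e X.1 ∈ periods μ e := by
    rw [mem_periods, add_smul, ← hXe]
    exact hV.fixes h0 hX
  rw [ha, AddSubgroup.mem_closure_singleton] at hp
  obtain ⟨n, hn⟩ := hp
  refine ⟨n, ?_⟩
  rw [zsmul_eq_mul] at hn
  change ((n : ℝ) * a / 2) • e = X.1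
  rw [hn, add_self_div_two, ← hXe]

theorem ae_area_eq_zero {e : EuclideanSpace ℝ (Fin 2)}
    (hs : ∀ X ∈ μ.support, area e X.1 = 0) : ∀ᵐ X ∂μ, area e X.1 = 0 := by
  filter_upwards [Measure.support_mem_ae (μ := μ)] with X hX using hs X hX

theorem map_strip_map_coords {e : EuclideanSpace ℝ (Fin 2)} (he : ‖e‖ = 1)
    (hs : ∀ X ∈ μ.support, area e X.1 = 0) : (μ.map (coords e)).map (strip e) = μ := by
  rw [Measure.map_map (continuous_strip e).measurable (continuous_coords e).measurable]
  conv_rhs => rw [← Measure.map_id (μ := μ)]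
  refine Measure.map_congr ?_
  filter_upwards [ae_area_eq_zero hs] with X hX using strip_coords he hX

/-- The fibres of `coords e` are not compact, but `μ` only charges the plane, where the preimage of
a compact set is its compact image under `strip e`. -/
theorem isLocallyFiniteMeasure_map_coords [IsLocallyFiniteMeasure μ]
    {e : EuclideanSpace ℝ (Fin 2)} (he : ‖e‖ = 1) (hs : ∀ X ∈ μ.support, area e X.1 = 0) :
    IsLocallyFiniteMeasure (μ.map (coords e)) := by
  have : IsFiniteMeasureOnCompacts (μ.map (coords e)) := ⟨fun K hK => by
    have e1 : μ.map (coords e) K = μ (strip e '' K) := by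
      conv_rhs => rw [← map_strip_map_coords he hs, (measurableEmbedding_strip he).map_apply,
        Set.preimage_image_eq _ (measurableEmbedding_strip he).injective]
    rw [e1]
    exact (hK.image (continuous_strip e)).measure_lt_top⟩
  exact isLocallyFiniteMeasure_of_isFiniteMeasureOnCompacts

/-- On the plane the twist vanishes, so a Heisenberg translation along `e` is an ordinary one. -/
theorem map_add_map_coords {e : EuclideanSpace ℝ (Fin 2)} (he : ‖e‖ = 1)
    (hs : ∀ X ∈ μ.support, area e X.1 = 0) {r : ℝ} (hr : r ∈ periods μ e) :
    (μ.map (coords e)).map (((r, 0) : ℝ × ℝ) + ·) = μ.map (coords e) := by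
  conv_rhs => rw [← mem_periods.1 hr]
  rw [Measure.map_map (measurable_const_add _) (continuous_coords e).measurable,
    Measure.map_map (continuous_coords e).measurable (continuous_mul_left _).measurable]
  refine Measure.map_congr ?_
  filter_upwards [ae_area_eq_zero hs] with X hX
  refine Prod.ext ?_ ?_
  · simp [coords, mul_fst, inner_add_right, inner_smul_right, he]
  · simp [coords, mul_snd, area_smul_left, hX]

/-- A vampiric `3`-regular measure is a product. -/
theorem IsVampiric.exists_eq_map_strip {C : ℝ} [IsLocallyFiniteMeasure μ]
    (hC : IsADR hdist 3 C μ) (hV : IsVampiric μ) (h0 : (0 : Heis) ∈ μ.support)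
    (hμ : μ.support.Nontrivial) :
    ∃ (e : EuclideanSpace ℝ (Fin 2)) (ν : Measure ℝ), ‖e‖ = 1 ∧ IsLocallyFiniteMeasure ν ∧
      μ = (volume.prod ν).map (strip e) ∧ distDiam hdist μ.support = ⊤ := by
  obtain ⟨e, he, hs⟩ := hV.exists_area_eq_zero hC h0 hμ
  have hd := hV.dense_periods hC h0 hμ he hs
  have hlf := isLocallyFiniteMeasure_map_coords he hs
  have hinv : ∀ r : ℝ, (μ.map (coords e)).map (((r, 0) : ℝ × ℝ) + ·) = μ.map (coords e) := by
    intro r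
    refine map_add_left_eq_of_mem_closure
      (T := (periods μ e).map (AddMonoidHom.inl ℝ ℝ)) ?_ ?_
    · rintro _ ⟨s, hs', rfl⟩
      exact map_add_map_coords he hs hs'
    · have hc : Continuous fun s : ℝ => ((s, 0) : ℝ × ℝ) := by fun_prop
      exact image_closure_subset_closure_image hc ⟨r, hd r, rfl⟩
  obtain ⟨ν, hν, hm⟩ := exists_eq_volume_prod hinv
  -- A nonzero period makes the support unbounded, so the regularity bounds hold at every positive
  -- radius.
  obtain ⟨r, hr0, hr⟩ := hd.exists_mem_open (isOpen_Ioi (a := (0 : ℝ))) ⟨1, Set.mem_Ioi.2 one_pos⟩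
  refine ⟨e, ν, he, hν, by rw [← hm, map_strip_map_coords he hs], ?_⟩
  refine (mem_periods.1 hr0).distDiam_support (smul_ne_zero (ne_of_gt hr) ?_) h0
  rintro rfl
  simp at he

/-! ### Regularity of the vertical factor -/

theorem hdist_strip {e : EuclideanSpace ℝ (Fin 2)} (he : ‖e‖ = 1) (p q : ℝ × ℝ) :
    hdist (strip e p) (strip e q) = Real.sqrt ((p.1 - q.1) ^ 2 + |p.2 - q.2|) := by
  rw [hdist_eq]
  simp [strip, ← sub_smul, norm_smul, he, area_smul_left, area_smul_right, area_self]

theorem strip_mem_support {e : EuclideanSpace ℝ (Fin 2)} {ν : Measure ℝ} [SFinite ν] {t : ℝ}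
    (ht : t ∈ ν.support) (r : ℝ) : strip e (r, t) ∈ ((volume.prod ν).map (strip e)).support := by
  rw [Measure.support_eq_forall_isOpen]
  intro U hU hUo
  rw [Measure.map_apply (continuous_strip e).measurable hUo.measurableSet]
  obtain ⟨A, hA, B, hB, hAB⟩ := mem_nhds_prod_iff.1
    ((hUo.preimage (continuous_strip e)).mem_nhds hU)
  refine lt_of_lt_of_le ?_ (measure_mono hAB)
  rw [Measure.prod_prod]
  exact ENNReal.mul_pos (Measure.measure_pos_of_mem_nhds volume hA).ne'
    ((Measure.mem_support_iff_forall _).1 ht B hB).ne'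

/-- The vertical factor of a `3`-regular product measure of infinite diameter is `2`-regular. -/
theorem isADR_timeDist {e : EuclideanSpace ℝ (Fin 2)} (he : ‖e‖ = 1) {ν : Measure ℝ} [SFinite ν]
    {C : ℝ} (hC : IsADR hdist 3 C ((volume.prod ν).map (strip e)))
    (hdiam : distDiam hdist ((volume.prod ν).map (strip e)).support = ⊤) :
    IsADR timeDist 2 (2 * C) ν := by
  have hC0 := hC.1
  refine ⟨by positivity, fun t ht r hr _ => ?_⟩
  have hball : ∀ R : ℝ, (volume.prod ν).map (strip e) {Y | hdist Y (strip e (0, t)) < R} =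
      (volume.prod ν) {p | Real.sqrt (p.1 ^ 2 + |p.2 - t|) < R} := by
    intro R
    rw [(measurableEmbedding_strip he).map_apply]
    congr 1
    ext p
    simp [hdist_strip he]
  have hadr := fun R (hR : 0 < R) => hC.2 _ (strip_mem_support ht 0) R hR
    (by rw [hdiam]; exact ENNReal.ofReal_lt_top)
  simp only [hball] at hadr
  set B := {y | timeDist y t < r} with hB
  have hBmem : ∀ y, y ∈ B ↔ |y - t| < r ^ 2 := fun y => by
    rw [hB, Set.mem_ofPred_eq, timeDist, Real.sqrt_lt' hr]
  have hprod : (volume.prod ν) (Set.Ioo (-r) r ×ˢ B) = ENNReal.ofReal (2 * r) * ν B := by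
    rw [Measure.prod_prod, Real.volume_Ioo]
    congr 2
    ring
  have h2r : ENNReal.ofReal (2 * r) ≠ 0 := by simpa using hr
  have hcancel : ∀ x y : ENNReal, ENNReal.ofReal (2 * r) * x ≤ ENNReal.ofReal (2 * r) * y →
      x ≤ y := fun x y h =>
    (ENNReal.mul_le_mul_iff_right h2r ENNReal.ofReal_ne_top).1 h
  constructor
  -- Lower bound: the ball of radius `r` lies in the box `(-r, r) × B`, of mass `2 * r * ν B`.
  · refine hcancel _ _ ?_
    rw [← ENNReal.ofReal_mul (by positivity), ← hprod]
    calc ENNReal.ofReal (2 * r * ((2 * C)⁻¹ * r ^ 2)) = ENNReal.ofReal (C⁻¹ * r ^ 3) := by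
          congr 1
          field_simp
      _ ≤ _ := (hadr r hr).1
      _ ≤ _ := by
          refine measure_mono fun p hp => ?_
          rw [Set.mem_ofPred_eq, Real.sqrt_lt' hr] at hp
          refine ⟨abs_lt.1 (abs_lt_of_sq_lt_sq ?_ hr.le), (hBmem _).2 ?_⟩
          · linarith [abs_nonneg (p.2 - t)]
          · linarith [sq_nonneg p.1]
  · refine hcancel _ _ ?_
    rw [← ENNReal.ofReal_mul (by positivity), ← hprod]
    -- In the box the squared gauge is below `2 * r ^ 2 < (3 / 2 * r) ^ 2`, and `(3 / 2) ^ 3 = 27 /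
    -- 8 ≤ 4` is what the constant `2 * C` allows after division by `2 * r`.
    calc (volume.prod ν) (Set.Ioo (-r) r ×ˢ B)
        ≤ (volume.prod ν) {p | Real.sqrt (p.1 ^ 2 + |p.2 - t|) < 3 / 2 * r} := by
          refine measure_mono ?_
          rintro ⟨x, y⟩ ⟨hx, hy⟩
          rw [Set.mem_ofPred_eq, Real.sqrt_lt' (by positivity)]
          have h1 := (hBmem _).1 hy
          have h2 : x ^ 2 < r ^ 2 := sq_lt_sq' hx.1 hx.2
          simp only at h1 ⊢
          nlinarith
      _ ≤ ENNReal.ofReal (C * (3 / 2 * r) ^ 3) := (hadr _ (by positivity)).2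
      _ ≤ _ := by
          refine ENNReal.ofReal_le_ofReal ?_
          have : 0 < C * r ^ 3 := by positivity
          nlinarith

end Heis

theorem theorem5p13 :
    (∀ C₀ : ℝ, ∃ A₀ : ℝ, ∀ μ : MeasureTheory.Measure Heis,
      MeasureTheory.IsLocallyFiniteMeasure μ → IsADR Heis.hdist 3 C₀ μ → Heis.IsVampiric μ →
      (0 : Heis) ∈ μ.support → μ.support.Nontrivial →
      ∃ (L : Submodule ℝ (EuclideanSpace ℝ (Fin 2))) (ν : MeasureTheory.Measure ℝ),
        Module.finrank ℝ L = 1 ∧ MeasureTheory.IsLocallyFiniteMeasure ν ∧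
        IsADR timeDist 2 A₀ ν ∧ μ = lineProd L ν) ∧
    (∀ (L : Submodule ℝ (EuclideanSpace ℝ (Fin 2))) (ν : MeasureTheory.Measure ℝ),
      Module.finrank ℝ L = 1 → MeasureTheory.IsLocallyFiniteMeasure ν →
      Heis.IsVampiric (lineProd L ν)) := by
  refine ⟨fun C₀ => ⟨2 * C₀, fun μ hlf hC hV h0 hμ => ?_⟩, fun L ν hL _ =>
    Heis.isVampiric_lineProd hL ν⟩
  obtain ⟨e, ν, he, hν, rfl, hdiam⟩ := hV.exists_eq_map_strip hC h0 hμ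
  exact ⟨Submodule.span ℝ {e}, ν, finrank_span_singleton (by rintro rfl; simp at he), hν,
    Heis.isADR_timeDist he hC hdiam, (Heis.lineProd_span he ν).symm⟩
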